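/- Let $X$ be a compact connected (Hausdorff) complex manifold of dimension $k$. Let $F$ be a holomorphic correspondence on $X$, that is, a formal sum $\Gamma=\sum_{j=1}^N m_j\Gamma_j$ with $N\ge 1$ and $m_j\in\mathbb{Z}_{>0}$, where the $\Gamma_j$ are distinct irreducible complex subvarieties of $X\times X$ of dimension $k$, each of which is mapped onto $X$ by both coordinate projections $\pi_1,\pi_2$, and such that every point of $X$ has only finitely many images and preimages, counted with multiplicity. Put $|\Gamma|=\bigcup_j\Gamma_j$, and for $A\subseteq X$ let $F(A)=\pi_2(\pi_1^{-1}(A)\cap|\Gamma|)$, $F^\dagger(A)=\pi_1(\pi_2^{-1}(A)\cap|\Gamma|)$, $F^0(A)=A$ and $F^{j+1}(A)=F(F^j(A))$. Let $d$ be the topological degree of $F$, i.e. the number of preimages (counted with the multiplicities $m_j$) of a generic point of $X$. Let $\mu$ be a Borel probability measure on $X$ that is $F^*$-invariant, i.e. $$\int_X \sideset{}{'}\sum_{w\in F^\dagger(z)}\phi(w)\,d\mu(z)=d\int_X\phi\,d\mu\qquad\text{for every continuous }\phi:X\to\mathbb{R},$$ where $\sum'$ means that the points $w$ are repeated according to multiplicity.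 Let $B\subseteq X$ be a Borel set that is almost invariant with respect to $F$ and $\mu$: there is a Borel set $B'\subseteq B$ with $\mu(B')=\mu(B)$ and $F^\dagger(B')\subseteq B$. Then for every Borel set $A\subseteq X$ the limit $$\lim_{n\to\infty}\frac1n\sum_{j=0}^{n-1}\mu\bigl(F^j(A)\cap B\bigr)$$ exists. In fact, the sequence $\bigl(\mu(F^j(A)\cap B)\bigr)_{j\ge 0}$ is increasing (non-decreasing). -/

import Mathlib

open Filter Topology MeasureTheory
open scoped Manifold ContDiff

section AnalyticGeometry

variable {E : Type*} [NormedAddCommGroup E] [NormedSpace ℂ E]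
  {H : Type*} [TopologicalSpace H] (I : ModelWithCorners ℂ E H)
  {M : Type*} [TopologicalSpace M] [ChartedSpace H M]

/-- A (closed) complex analytic subset of `M`, i.e. a complex subvariety: every point of `M` has an
open neighbourhood `U` in which `S` is the common zero set of finitely many holomorphic functions
on `U`. -/
def IsComplexAnalyticSubset (S : Set M) : Prop :=
  ∀ p : M, ∃ U : Set M, IsOpen U ∧ p ∈ U ∧ ∃ (n : ℕ) (f : Fin n → M → ℂ),
    (∀ i, MDifferentiableOn I 𝓘(ℂ, ℂ) (f i) U) ∧
    S ∩ U = {x ∈ U | ∀ i, f i x = 0}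

/-- An irreducible complex subvariety of `M`: a nonempty analytic subset which is not the union of
two proper analytic subsets. -/
def IsIrreducibleSubvariety (S : Set M) : Prop :=
  IsComplexAnalyticSubset I S ∧ S.Nonempty ∧
    ∀ S₁ S₂ : Set M, IsComplexAnalyticSubset I S₁ → IsComplexAnalyticSubset I S₂ →
      S = S₁ ∪ S₂ → S₁ = S ∨ S₂ = S

/-- `p` is a regular point of `S` at which `S` is a complex submanifold of dimension `e`: near `p`,
`S` is the zero set of a holomorphic map to `ℂ^m` that is submersive at `p`,
where `e + m = dim M`. -/
def IsRegularPointOfDim (S : Set M) (e : ℕ) (p : M) : Prop :=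
  p ∈ S ∧ ∃ m : ℕ, e + m = Module.finrank ℂ E ∧
    ∃ (U : Set M) (f : M → (Fin m → ℂ)), IsOpen U ∧ p ∈ U ∧
      MDifferentiableOn I 𝓘(ℂ, Fin m → ℂ) f U ∧
      Function.Surjective (mfderiv I 𝓘(ℂ, Fin m → ℂ) f p) ∧
      S ∩ U = {x ∈ U | f x = 0}

/-- The dimension of a nonempty subvariety is the greatest dimension attained at a regular point.
(For an irreducible subvariety all regular points have the same dimension.) -/
def HasComplexDimension (S : Set M) (e : ℕ) : Prop :=
  IsGreatest {e' : ℕ | ∃ p : M, IsRegularPointOfDim I S e' p} e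

end AnalyticGeometry

/-- The local multiplicity at `p` of the restriction to `S` of a map `f` with finite fibres: the
number of points of `S` near `p` in a generic fibre of `f` close to the fibre of `p`, i.e.
`inf_U limsup_{y → f p} #(S ∩ U ∩ f⁻¹ y)`, the infimum being over the neighbourhoods `U` of `p`. -/
noncomputable def localMultiplicity {Y Z : Type*} [TopologicalSpace Y] [TopologicalSpace Z]
    (f : Y → Z) (S : Set Y) (p : Y) : ℕ∞ :=
  ⨅ U ∈ 𝓝 p, limsup (fun y : Z => (S ∩ U ∩ f ⁻¹' {y}).encard) (𝓝 (f p))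

/-- A holomorphic correspondence `∑ j, m j • Γ j` on a complex manifold `X` of dimension `k`. -/
structure HolomorphicCorrespondence (k : ℕ) (X : Type*) [TopologicalSpace X]
    [ChartedSpace (EuclideanSpace ℂ (Fin k)) X] where
  /-- number of components -/
  N : ℕ
  N_pos : 0 < N
  /-- multiplicities of the components -/
  m : Fin N → ℕ
  m_pos : ∀ j, 0 < m j
  /-- the components -/
  Γ : Fin N → Set (X × X)
  distinct : Function.Injective Γ
  irreducible : ∀ j, IsIrreducibleSubvariety
    (𝓘(ℂ, EuclideanSpace ℂ (Fin k)).prod 𝓘(ℂ, EuclideanSpace ℂ (Fin k))) (Γ j)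
  dimension : ∀ j, HasComplexDimension
    (𝓘(ℂ, EuclideanSpace ℂ (Fin k)).prod 𝓘(ℂ, EuclideanSpace ℂ (Fin k))) (Γ j) k
  surjective_fst : ∀ j, Set.SurjOn Prod.fst (Γ j) Set.univ
  surjective_snd : ∀ j, Set.SurjOn Prod.snd (Γ j) Set.univ
  /-- the images of a point, repeated according to multiplicity, are finite in number -/
  finite_image : ∀ z₀ : X,
    (⋃ j, Prod.snd '' (Prod.fst ⁻¹' {z₀} ∩ Γ j)).Finite ∧
      ∀ j, ∀ p ∈ Prod.fst ⁻¹' {z₀} ∩ Γ j, localMultiplicity Prod.fst (Γ j) p ≠ ⊤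
  /-- the preimages of a point, repeated according to multiplicity, are finite in number -/
  finite_preimage : ∀ z₀ : X,
    (⋃ j, Prod.fst '' (Prod.snd ⁻¹' {z₀} ∩ Γ j)).Finite ∧
      ∀ j, ∀ p ∈ Prod.snd ⁻¹' {z₀} ∩ Γ j, localMultiplicity Prod.snd (Γ j) p ≠ ⊤

namespace HolomorphicCorrespondence

variable {k : ℕ} {X : Type*} [TopologicalSpace X] [ChartedSpace (EuclideanSpace ℂ (Fin k)) X]
  (F : HolomorphicCorrespondence k X)

/-- The support `|Γ| = ⋃ j, Γ j`. -/
def support : Set (X × X) := ⋃ j, F.Γ j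

/-- The image `F(A)`. -/
def image (A : Set X) : Set X := Prod.snd '' (Prod.fst ⁻¹' A ∩ F.support)

/-- The preimage `F†(A)`. -/
def preimage (A : Set X) : Set X := Prod.fst '' (Prod.snd ⁻¹' A ∩ F.support)

/-- The multiplicity with which `w` occurs among the preimages of `z`. -/
noncomputable def preimageMultiplicity (z w : X) : ℕ :=
  ∑ j, F.m j * (localMultiplicity Prod.snd (F.Γ j) (w, z)).toNat

/-- The sum of `φ` over the preimages of `z`, repeated according to multiplicity. -/
noncomputable def preimageSum (φ : X → ℝ) (z : X) : ℝ :=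
  ∑ᶠ w ∈ F.preimage {z}, (F.preimageMultiplicity z w : ℝ) * φ w

/-- `d` is the number of preimages of a generic point, i.e. of every point outside some nowhere
dense analytic subset, where each point of a component `Γ j` over it counts `m j` times. -/
def IsGenericPreimageNumber (d : ℕ) : Prop :=
  ∃ Z : Set X, IsComplexAnalyticSubset 𝓘(ℂ, EuclideanSpace ℂ (Fin k)) Z ∧ interior Z = ∅ ∧
    ∀ z ∉ Z, ∑ j, F.m j * {w : X | (w, z) ∈ F.Γ j}.ncard = d

/-- The topological degree of `F`: the number of preimages of a generic point. (On a nonempty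
space at most one `d` is a generic preimage number, so the infimum just picks it out.) -/
noncomputable def topologicalDegree : ℕ := sInf {d : ℕ | F.IsGenericPreimageNumber d}

variable [MeasurableSpace X]

/-- `μ` is `F^*`-invariant: `F^* μ = d μ`, where `d` is the topological degree of `F` and
`⟨F^* μ, φ⟩` is the integral of `z ↦ F.preimageSum φ z` for continuous `φ`. -/
def IsPullbackInvariant (μ : Measure X) : Prop :=
  ∀ φ : C(X, ℝ), Integrable (F.preimageSum φ) μ ∧
    ∫ z, F.preimageSum φ z ∂μ = F.topologicalDegree * ∫ z, φ z ∂μ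

/-- The Borel set `B` is almost invariant with respect to `F` and `μ`. -/
def IsAlmostInvariant (μ : Measure X) (B : Set X) : Prop :=
  MeasurableSet B ∧ ∃ B' : Set X, MeasurableSet B' ∧ B' ⊆ B ∧ μ B = μ B' ∧ F.preimage B' ⊆ B

end HolomorphicCorrespondence

open scoped ENNReal NNReal BoundedContinuousFunction

section AnalyticGeometry

variable {E : Type*} [NormedAddCommGroup E] [NormedSpace ℂ E]
  {H : Type*} [TopologicalSpace H] {I : ModelWithCorners ℂ E H}
  {M : Type*} [TopologicalSpace M] [ChartedSpace H M]

/-! Attach to `z` the measure `κ_z` of its preimages with multiplicity. Invariance, stated for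
continuous functions, extends to Borel sets: `∫ κ_z(E) dμ = d μ(E)`. Fibre counts are upper
semicontinuous and generically equal `d`, so `κ_z(X) ≥ d` everywhere; the mean is `d`, hence `κ_z(X)
= d` almost everywhere.

Over `B'` all preimages lie in `B`, so `B'` alone contributes `d μ(B') = d μ(B)` to `∫ κ_z(B) dμ`,
and almost no point outside `B'` has a preimage in `B`. If `K ⊆ B'` is compact and misses `F(C)`,
then `F†(K)` misses `C`. With `E = B \ F†(K)`, only points of `B' \ K` contribute to `∫ κ_z(E) dμ`,
each at most `d`, so `μ(C ∩ B) ≤ μ(E) ≤ μ(B' \ K)`. Letting `K` exhaust `B' \ F(C)` gives `μ(C ∩ B)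
≤ μ(F(C) ∩ B)`. Take `C = F^j(A)`; a bounded monotone sequence has convergent Cesàro means. -/

theorem IsComplexAnalyticSubset.isClosed {S : Set M} (hS : IsComplexAnalyticSubset I S) :
    IsClosed S := by
  rw [← isOpen_compl_iff, isOpen_iff_mem_nhds]
  intro p hp
  obtain ⟨U, hU, hpU, n, f, hf, hSU⟩ := hS p
  have hne : ∃ i, f i p ≠ 0 := by
    by_contra! h
    have : p ∈ S ∩ U := hSU ▸ ⟨hpU, h⟩
    exact hp this.1
  obtain ⟨i, hi⟩ := hne
  have hc : ContinuousAt (f i) p := (hf i).continuousOn.continuousAt (hU.mem_nhds hpU)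
  filter_upwards [hc.eventually_ne hi, hU.mem_nhds hpU] with x hx hxU hxS
  have : x ∈ {x ∈ U | ∀ i, f i x = 0} := hSU ▸ ⟨hxS, hxU⟩
  exact hx (this.2 i)

end AnalyticGeometry

/-! ### Upper semicontinuity of fibre counts -/

theorem exists_mem_nhds_eventually_encard_le_localMultiplicity {Y Z : Type*} [TopologicalSpace Y]
    [TopologicalSpace Z] (f : Y → Z) (S : Set Y) (p : Y) :
    ∃ U ∈ 𝓝 p, ∀ᶠ y in 𝓝 (f p),
      (S ∩ U ∩ f ⁻¹' {y}).encard ≤ localMultiplicity f S p := by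
  by_cases htop : localMultiplicity f S p = ⊤
  · exact ⟨Set.univ, univ_mem, by simp [htop]⟩
  -- Counts are integers, so it suffices to get strictly below `m + 1`; this needs `m` finite.
  have hlt : localMultiplicity f S p < localMultiplicity f S p + 1 :=
    ENat.lt_add_one_iff htop |>.2 le_rfl
  nth_rewrite 1 [localMultiplicity] at hlt
  simp only [iInf_lt_iff] at hlt
  obtain ⟨U, hU, hlt⟩ := hlt
  exact ⟨U, hU, (eventually_lt_of_limsup_lt hlt).mono fun y hy => (ENat.lt_add_one_iff htop).1 hy⟩

/-- Upper semicontinuity of the number of points in the fibres of a closed relation, counted with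
local multiplicity. -/
theorem IsClosed.eventually_encard_fibre_le_sum_localMultiplicity {Y Z : Type*}
    [TopologicalSpace Y] [CompactSpace Y] [TopologicalSpace Z] {S : Set (Y × Z)}
    (hS : IsClosed S) {z : Z} (T : Finset Y) (hT : ∀ w, (w, z) ∈ S → w ∈ T) :
    ∀ᶠ y in 𝓝 z,
      {w | (w, y) ∈ S}.encard ≤ ∑ w ∈ T, localMultiplicity Prod.snd S (w, z) := by
  choose U hU hUle using fun w : Y =>
    exists_mem_nhds_eventually_encard_le_localMultiplicity (Prod.snd : Y × Z → Z) S (w, z)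
  have hle : ∀ᶠ y in 𝓝 z, ∀ w ∈ T, (S ∩ U w ∩ Prod.snd ⁻¹' {y}).encard ≤
      localMultiplicity Prod.snd S (w, z) :=
    (eventually_all_finset T).2 fun w _ => hUle w
  have hcover : ∀ᶠ y in 𝓝 z, ∀ w, (w, y) ∈ S → ∃ t ∈ T, (w, y) ∈ U t := by
    -- The part of `S` missed by the neighbourhoods is closed, and projecting along the compact
    -- factor keeps it so.
    have hC : IsClosed (S \ ⋃ t ∈ T, interior (U t)) :=
      hS.sdiff (isOpen_biUnion fun _ _ => isOpen_interior)
    have hz : z ∉ Prod.snd '' (S \ ⋃ t ∈ T, interior (U t)) := by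
      rintro ⟨⟨w, z'⟩, ⟨hwS, hwU⟩, rfl⟩
      exact hwU (Set.mem_biUnion (hT w hwS) (mem_interior_iff_mem_nhds.2 (hU w)))
    filter_upwards [(isClosedMap_snd_of_compactSpace _ hC).isOpen_compl.mem_nhds hz] with y hy w hw
    by_contra! h
    refine hy ⟨(w, y), ⟨hw, ?_⟩, rfl⟩
    simp only [Set.mem_iUnion, not_exists]
    exact fun t ht hmem => h t ht (interior_subset hmem)
  filter_upwards [hle, hcover] with y hy hcov
  calc {w | (w, y) ∈ S}.encard
      = ((fun w => (w, y)) '' {w | (w, y) ∈ S}).encard :=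
        ((Prod.mk_left_injective y).encard_image _).symm
    _ ≤ (⋃ t ∈ T, S ∩ U t ∩ Prod.snd ⁻¹' {y}).encard := by
        refine Set.encard_le_encard ?_
        rintro _ ⟨w, hw, rfl⟩
        obtain ⟨t, ht, hwt⟩ := hcov w hw
        exact Set.mem_biUnion ht ⟨⟨hw, hwt⟩, rfl⟩
    _ ≤ ∑ t ∈ T, (S ∩ U t ∩ Prod.snd ⁻¹' {y}).encard := T.set_encard_biUnion_le _
    _ ≤ _ := Finset.sum_le_sum hy

/-! ### From continuous functions to Borel sets -/

/-- If a family of finite measures disintegrates `ν` against continuous functions, then it does so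
against Borel sets. -/
theorem aemeasurable_and_lintegral_apply_of_forall_boundedContinuous {Ω X : Type*}
    [MeasurableSpace Ω] [TopologicalSpace X] [MeasurableSpace X] [BorelSpace X]
    [HasOuterApproxClosed X] {μ : Measure Ω} {ν : Measure X} [IsFiniteMeasure ν]
    {κ : Ω → Measure X} [∀ z, IsFiniteMeasure (κ z)]
    (h : ∀ φ : X →ᵇ ℝ≥0, AEMeasurable (fun z => ∫⁻ x, φ x ∂κ z) μ ∧
      ∫⁻ z, ∫⁻ x, φ x ∂κ z ∂μ = ∫⁻ x, φ x ∂ν) {E : Set X} (hE : MeasurableSet E) :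
    AEMeasurable (fun z => κ z E) μ ∧ ∫⁻ z, κ z E ∂μ = ν E := by
  have huniv : AEMeasurable (fun z => κ z Set.univ) μ ∧ ∫⁻ z, κ z Set.univ ∂μ = ν Set.univ := by
    simpa using h 1
  have hfin : ∫⁻ z, κ z Set.univ ∂μ ≠ ⊤ := huniv.2 ▸ measure_ne_top ν _
  induction E, hE using MeasurableSpace.induction_on_inter
    ((BorelSpace.measurable_eq (α := X)).trans borel_eq_generateFrom_isClosed)
    isPiSystem_isClosed with
  | empty => simp
  | basic E hE =>
    have hE : IsClosed E := hE
    have hlim (z : Ω) := HasOuterApproxClosed.tendsto_lintegral_apprSeq hE (κ z)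
    refine ⟨aemeasurable_of_tendsto_metrizable_ae atTop (fun n => (h (hE.apprSeq n)).1)
      (ae_of_all _ hlim), ?_⟩
    refine tendsto_nhds_unique (tendsto_lintegral_of_dominated_convergence' _
      (fun n => (h (hE.apprSeq n)).1) (fun n => ae_of_all _ fun z => ?_) hfin
      (ae_of_all _ hlim)) ?_
    · calc ∫⁻ x, hE.apprSeq n x ∂κ z ≤ ∫⁻ _, 1 ∂κ z :=
            lintegral_mono fun x => by
              exact ENNReal.coe_le_one_iff.2 (HasOuterApproxClosed.apprSeq_apply_le_one hE n x)
        _ = κ z Set.univ := by simp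
    · simpa only [(h _).2] using HasOuterApproxClosed.tendsto_lintegral_apprSeq hE ν
  | compl E hE ih =>
    have hc (z : Ω) : κ z Eᶜ = κ z Set.univ - κ z E := measure_compl hE (measure_ne_top _ _)
    simp only [hc]
    refine ⟨huniv.1.sub ih.1, ?_⟩
    rw [lintegral_sub' ih.1 (ih.2 ▸ measure_ne_top ν _)
      (ae_of_all _ fun z => measure_mono (Set.subset_univ _)), huniv.2, ih.2,
      measure_compl hE (measure_ne_top _ _)]
  | iUnion f hd hf ih =>
    have hu (z : Ω) : κ z (⋃ i, f i) = ∑' i, κ z (f i) := measure_iUnion hd hf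
    simp only [hu]
    refine ⟨AEMeasurable.tsum fun i => (ih i).1, ?_⟩
    rw [lintegral_tsum fun i => (ih i).1, measure_iUnion hd hf]
    exact tsum_congr fun i => (ih i).2

/-! ### Preimages under a correspondence -/

namespace HolomorphicCorrespondence

variable {k : ℕ} {X : Type*} [TopologicalSpace X] [ChartedSpace (EuclideanSpace ℂ (Fin k)) X]
  (F : HolomorphicCorrespondence k X)

theorem isClosed_component (j : Fin F.N) : IsClosed (F.Γ j) := (F.irreducible j).1.isClosed

theorem isClosed_support : IsClosed F.support := isClosed_iUnion_of_finite F.isClosed_component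

theorem mem_preimage {A : Set X} {w : X} :
    w ∈ F.preimage A ↔ ∃ z ∈ A, (w, z) ∈ F.support := by
  simp [preimage]

theorem mem_preimage_singleton {z w : X} : w ∈ F.preimage {z} ↔ (w, z) ∈ F.support := by
  simp [mem_preimage]

theorem finite_preimage_singleton (z : X) : (F.preimage {z}).Finite := by
  refine (F.finite_preimage z).1.subset ?_
  intro w hw
  obtain ⟨j, hj⟩ := Set.mem_iUnion.1 (F.mem_preimage_singleton.1 hw)
  exact Set.mem_iUnion.2 ⟨j, (w, z), ⟨rfl, hj⟩, rfl⟩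

theorem isClosed_preimage [CompactSpace X] {K : Set X} (hK : IsClosed K) :
    IsClosed (F.preimage K) :=
  isClosedMap_fst_of_compactSpace _ ((hK.preimage continuous_snd).inter F.isClosed_support)

/-- The number of preimages of nearby points is at most the number of preimages of `z` counted with
multiplicity. -/
theorem eventually_sum_ncard_le_sum_preimageMultiplicity [CompactSpace X] (z : X) :
    ∀ᶠ y in 𝓝 z, ∑ j, F.m j * {w : X | (w, y) ∈ F.Γ j}.ncard ≤
      ∑ w ∈ (F.finite_preimage_singleton z).toFinset, F.preimageMultiplicity z w := by
  classical
  let T (j : Fin F.N) : Finset X :=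
    (F.finite_preimage_singleton z).toFinset.filter fun w => (w, z) ∈ F.Γ j
  have key (j : Fin F.N) : ∀ᶠ y in 𝓝 z, {w : X | (w, y) ∈ F.Γ j}.encard ≤
      ∑ w ∈ T j, localMultiplicity Prod.snd (F.Γ j) (w, z) := by
    refine (F.isClosed_component j).eventually_encard_fibre_le_sum_localMultiplicity (T j) ?_
    intro w hw
    simp only [T, Finset.mem_filter, Set.Finite.mem_toFinset]
    exact ⟨F.mem_preimage_singleton.2 (Set.mem_iUnion.2 ⟨j, hw⟩), hw⟩
  filter_upwards [eventually_all.2 key] with y hy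
  simp only [preimageMultiplicity]
  rw [Finset.sum_comm]
  refine Finset.sum_le_sum fun j _ => ?_
  rw [← Finset.mul_sum]
  refine Nat.mul_le_mul_left _ ?_
  calc {w : X | (w, y) ∈ F.Γ j}.ncard
      ≤ ∑ w ∈ T j, (localMultiplicity Prod.snd (F.Γ j) (w, z)).toNat := by
        rw [Set.ncard]
        refine ENat.toNat_le_of_le_natCast ((hy j).trans_eq ?_)
        rw [Nat.cast_sum]
        refine Finset.sum_congr rfl fun w hw => (ENat.natCast_toNat ?_).symm
        -- Finiteness is essential: `toNat` sends `⊤` to `0`.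
        exact (F.finite_preimage z).2 j _ ⟨rfl, (Finset.mem_filter.1 hw).2⟩
    _ ≤ _ := Finset.sum_le_sum_of_subset (Finset.filter_subset _ _)

theorem one_le_sum_preimageMultiplicity [CompactSpace X] (z : X) :
    1 ≤ ∑ w ∈ (F.finite_preimage_singleton z).toFinset, F.preimageMultiplicity z w := by
  refine le_trans ?_ (F.eventually_sum_ncard_le_sum_preimageMultiplicity z).self_of_nhds
  let j : Fin F.N := ⟨0, F.N_pos⟩
  have hfin : {w : X | (w, z) ∈ F.Γ j}.Finite :=
    (F.finite_preimage_singleton z).subset fun w hw =>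
      F.mem_preimage_singleton.2 (Set.mem_iUnion.2 ⟨j, hw⟩)
  obtain ⟨⟨w, z'⟩, hw, hz : z' = z⟩ := F.surjective_snd j (Set.mem_univ z)
  rw [hz] at hw
  have hpos : 0 < {w : X | (w, z) ∈ F.Γ j}.ncard := (Set.ncard_pos hfin).2 ⟨w, hw⟩
  exact (Nat.mul_pos (F.m_pos j) hpos).trans_le
    (Finset.single_le_sum (f := fun j => F.m j * {w : X | (w, z) ∈ F.Γ j}.ncard)
      (fun _ _ => Nat.zero_le _) (Finset.mem_univ j))

/-- Every neighbourhood of `z` meets the dense set where the count is `d`. -/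
theorem le_sum_preimageMultiplicity_of_isGenericPreimageNumber [CompactSpace X]
    {d : ℕ} (hd : F.IsGenericPreimageNumber d) (z : X) :
    d ≤ ∑ w ∈ (F.finite_preimage_singleton z).toFinset, F.preimageMultiplicity z w := by
  obtain ⟨Z, -, hZ, hcount⟩ := hd
  have hdense : Dense Zᶜ := interior_eq_empty_iff_dense_compl.1 hZ
  obtain ⟨y, hy, hyZ⟩ :=
    mem_closure_iff_nhds.1 (hdense z) _ (F.eventually_sum_ncard_le_sum_preimageMultiplicity z)
  exact (hcount y hyZ) ▸ hy

/-! ### The preimage measures -/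

variable [MeasurableSpace X]

/-- The sum of the point masses at the preimages of `z`, repeated according to multiplicity. -/
noncomputable def preimageMeasure (z : X) : Measure X :=
  ∑ w ∈ (F.finite_preimage_singleton z).toFinset,
    (F.preimageMultiplicity z w : ℝ≥0) • Measure.dirac w

instance (z : X) : IsFiniteMeasure (F.preimageMeasure z) := by
  unfold preimageMeasure; infer_instance

theorem lintegral_preimageMeasure [MeasurableSingletonClass X] (z : X) (φ : X → ℝ≥0) :
    ∫⁻ w, φ w ∂F.preimageMeasure z = ENNReal.ofReal (F.preimageSum (fun w => φ w) z) := by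
  rw [preimageMeasure, preimageSum, lintegral_finsetSum_measure,
    finsum_mem_eq_finite_toFinset_sum _ (F.finite_preimage_singleton z),
    ENNReal.ofReal_sum_of_nonneg fun w _ => by positivity]
  refine Finset.sum_congr rfl fun w _ => ?_
  rw [lintegral_smul_measure, lintegral_dirac, ENNReal.ofReal_mul (by positivity)]
  simp [ENNReal.smul_def]

theorem preimageMeasure_univ [MeasurableSingletonClass X] (z : X) :
    F.preimageMeasure z Set.univ =
      (∑ w ∈ (F.finite_preimage_singleton z).toFinset, F.preimageMultiplicity z w : ℕ) := by
  simp [preimageMeasure, ENNReal.smul_def]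

theorem preimageMeasure_apply_eq_zero [MeasurableSingletonClass X] {z : X} {E : Set X}
    (h : ∀ w ∈ F.preimage {z}, w ∉ E) : F.preimageMeasure z E = 0 := by
  simp only [preimageMeasure, Measure.coe_finsetSum, Finset.sum_apply]
  refine Finset.sum_eq_zero fun w hw => ?_
  have : w ∉ E := h w (by simpa using hw)
  simp [this]

variable {F} {μ : Measure X} [IsProbabilityMeasure μ]

/-! ### Consequences of invariance -/

namespace IsPullbackInvariant

theorem lintegral_preimageMeasure_apply [BorelSpace X] [MeasurableSingletonClass X]
    [HasOuterApproxClosed X] (hμ : F.IsPullbackInvariant μ)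
    {E : Set X} (hE : MeasurableSet E) :
    AEMeasurable (fun z => F.preimageMeasure z E) μ ∧
      ∫⁻ z, F.preimageMeasure z E ∂μ = F.topologicalDegree * μ E := by
  have := aemeasurable_and_lintegral_apply_of_forall_boundedContinuous
    (μ := μ) (ν := (F.topologicalDegree : ℝ≥0) • μ) (κ := F.preimageMeasure) ?_ hE
  · simpa [ENNReal.smul_def] using this
  intro φ
  obtain ⟨hint, heq⟩ : Integrable (F.preimageSum fun x => (φ x : ℝ)) μ ∧
      ∫ z, F.preimageSum (fun x => (φ x : ℝ)) z ∂μ = F.topologicalDegree * ∫ x, (φ x : ℝ) ∂μ :=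
    hμ ⟨fun x => (φ x : ℝ), by fun_prop⟩
  have hnonneg (z : X) : 0 ≤ F.preimageSum (fun x => (φ x : ℝ)) z :=
    finsum_nonneg fun _ => finsum_nonneg fun _ => by positivity
  simp only [lintegral_preimageMeasure]
  refine ⟨hint.aemeasurable.ennreal_ofReal, ?_⟩
  rw [← ofReal_integral_eq_lintegral_ofReal hint (ae_of_all _ hnonneg)]
  rw [heq, ENNReal.ofReal_mul (by positivity), lintegral_smul_measure,
    lintegral_coe_eq_integral _ (φ.integrable_of_nnreal μ)]
  simp [ENNReal.smul_def]

variable [CompactSpace X] [BorelSpace X] [MeasurableSingletonClass X] [HasOuterApproxClosed X]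

/-- Every `κ_z` has mass at least 1, so its mean is not `0`. This excludes the default value `sInf ∅
= 0`, so the degree is a true generic count. -/
theorem topologicalDegree_ne_zero (hμ : F.IsPullbackInvariant μ) : F.topologicalDegree ≠ 0 := by
  intro h
  have h1 : (1 : ℝ≥0∞) ≤ ∫⁻ z, F.preimageMeasure z Set.univ ∂μ :=
    calc (1 : ℝ≥0∞) = ∫⁻ _, 1 ∂μ := by simp
      _ ≤ _ := lintegral_mono fun z => by
        beta_reduce
        rw [preimageMeasure_univ]
        exact_mod_cast F.one_le_sum_preimageMultiplicity z
  rw [(hμ.lintegral_preimageMeasure_apply .univ).2, h] at h1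
  simp at h1

theorem isGenericPreimageNumber_topologicalDegree (hμ : F.IsPullbackInvariant μ) :
    F.IsGenericPreimageNumber F.topologicalDegree :=
  Nat.sInf_mem (Nat.nonempty_of_pos_sInf (Nat.pos_of_ne_zero hμ.topologicalDegree_ne_zero))

/-- Almost every point has exactly `d` preimages, counted with multiplicity. -/
theorem ae_preimageMeasure_univ (hμ : F.IsPullbackInvariant μ) :
    ∀ᵐ z ∂μ, F.preimageMeasure z Set.univ = F.topologicalDegree := by
  obtain ⟨hmeas, hint⟩ := hμ.lintegral_preimageMeasure_apply .univ
  have hle (z : X) : (F.topologicalDegree : ℝ≥0∞) ≤ F.preimageMeasure z Set.univ := by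
    rw [preimageMeasure_univ]
    exact_mod_cast F.le_sum_preimageMultiplicity_of_isGenericPreimageNumber
      hμ.isGenericPreimageNumber_topologicalDegree z
  -- A pointwise inequality between functions with equal finite integrals is an equality almost
  -- everywhere.
  have := ae_eq_of_ae_le_of_lintegral_le (μ := μ) (ae_of_all _ hle) (by simp) hmeas
    (by simp [hint])
  filter_upwards [this] with z hz using hz.symm

/-- Almost no point outside `B'` has a preimage in `B`. -/
theorem setLIntegral_compl_eq_zero (hμ : F.IsPullbackInvariant μ) {B B' : Set X}
    (hB : MeasurableSet B) (hB' : MeasurableSet B') (heq : μ B = μ B')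
    (hpre : F.preimage B' ⊆ B) : ∫⁻ z in B'ᶜ, F.preimageMeasure z B ∂μ = 0 := by
  have hin : ∫⁻ z in B', F.preimageMeasure z B ∂μ = F.topologicalDegree * μ B := by
    rw [heq, ← setLIntegral_const]
    refine setLIntegral_congr_fun_ae hB' ?_
    filter_upwards [hμ.ae_preimageMeasure_univ] with z hz hzB
    rw [← hz, ← measure_add_measure_compl hB, F.preimageMeasure_apply_eq_zero (E := Bᶜ),
      add_zero]
    intro w hw hwB
    exact hwB (hpre (F.mem_preimage.2 ⟨z, hzB, F.mem_preimage_singleton.1 hw⟩))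
  have htot := lintegral_add_compl (μ := μ) (fun z => F.preimageMeasure z B) hB'
  rw [hin, (hμ.lintegral_preimageMeasure_apply hB).2] at htot
  exact (ENNReal.add_right_inj (by finiteness)).1 (htot.trans (add_zero _).symm)

theorem measure_inter_compl_preimage_le (hμ : F.IsPullbackInvariant μ) {B B' K : Set X}
    (hB : MeasurableSet B) (hB' : MeasurableSet B') (heq : μ B = μ B')
    (hpre : F.preimage B' ⊆ B) (hK : IsClosed K) :
    μ ((F.preimage K)ᶜ ∩ B) ≤ μ (B' \ K) := by
  have hE : MeasurableSet ((F.preimage K)ᶜ ∩ B) :=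
    (F.isClosed_preimage hK).isOpen_compl.measurableSet.inter hB
  have hzero : ∫⁻ z in B'ᶜ, F.preimageMeasure z ((F.preimage K)ᶜ ∩ B) ∂μ = 0 :=
    le_antisymm ((lintegral_mono fun z => measure_mono Set.inter_subset_right).trans_eq
      (hμ.setLIntegral_compl_eq_zero hB hB' heq hpre)) zero_le
  have hle : ∫⁻ z in B', F.preimageMeasure z ((F.preimage K)ᶜ ∩ B) ∂μ ≤
      F.topologicalDegree * μ (B' \ K) := by
    rw [← setLIntegral_const, ← lintegral_indicator hB',
      ← lintegral_indicator (hB'.diff hK.measurableSet)]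
    refine lintegral_mono_ae ?_
    filter_upwards [hμ.ae_preimageMeasure_univ] with z hz
    by_cases hzB : z ∈ B'
    · by_cases hzK : z ∈ K
      · rw [Set.indicator_of_mem hzB, F.preimageMeasure_apply_eq_zero]
        · exact zero_le
        · intro w hw hwE
          exact hwE.1 (F.mem_preimage.2 ⟨z, hzK, F.mem_preimage_singleton.1 hw⟩)
      · rw [Set.indicator_of_mem hzB, Set.indicator_of_mem (show z ∈ B' \ K from ⟨hzB, hzK⟩),
          ← hz]
        exact measure_mono (Set.subset_univ _)
    · simp [hzB]
  have htot := lintegral_add_compl (μ := μ)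
    (fun z => F.preimageMeasure z ((F.preimage K)ᶜ ∩ B)) hB'
  rw [hzero, add_zero, (hμ.lintegral_preimageMeasure_apply hE).2] at htot
  rw [htot] at hle
  exact (ENNReal.mul_le_mul_iff_right (by exact_mod_cast hμ.topologicalDegree_ne_zero)
    (by simp)).1 hle

/-- No measurability of `C` or `F.image C` is needed: `μ` is taken as an outer measure. -/
theorem measure_inter_le_measure_image_inter [μ.InnerRegularCompactLTTop] [T2Space X]
    (hμ : F.IsPullbackInvariant μ) {B : Set X}
    (hB : F.IsAlmostInvariant μ B) (C : Set X) : μ (C ∩ B) ≤ μ (F.image C ∩ B) := by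
  obtain ⟨hBm, B', hB', hsub, heq, hpre⟩ := hB
  let G := toMeasurable μ (F.image C ∩ B)
  have hG : MeasurableSet G := measurableSet_toMeasurable _ _
  refine ENNReal.le_of_forall_pos_le_add fun ε hε _ => ?_
  -- `F(C)` need not be measurable, hence the hull `G`; compactness of `K` makes `F†(K)` closed,
  -- hence Borel.
  obtain ⟨K, hKsub, hK, hKlt⟩ := (hB'.diff hG).exists_isCompact_sdiff_lt
    (measure_ne_top μ _) (ε := ε) (by simpa using hε.ne')
  have hC : C ⊆ (F.preimage K)ᶜ := by
    intro w hwC hw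
    obtain ⟨z, hzK, hwz⟩ := F.mem_preimage.1 hw
    exact (hKsub hzK).2 (subset_toMeasurable μ _
      ⟨⟨(w, z), ⟨hwC, hwz⟩, rfl⟩, hsub (hKsub hzK).1⟩)
  calc μ (C ∩ B) ≤ μ ((F.preimage K)ᶜ ∩ B) := measure_mono (Set.inter_subset_inter_left _ hC)
    _ ≤ μ (B' \ K) := hμ.measure_inter_compl_preimage_le hBm hB' heq hpre hK.isClosed
    _ ≤ μ (G ∪ ((B' \ G) \ K)) := measure_mono fun z hz => by
        by_cases hzG : z ∈ G
        · exact Or.inl hzG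
        · exact Or.inr ⟨⟨hz.1, hzG⟩, hz.2⟩
    _ ≤ μ G + μ ((B' \ G) \ K) := measure_union_le _ _
    _ ≤ μ (F.image C ∩ B) + ε := add_le_add (measure_toMeasurable _).le hKlt.le

end IsPullbackInvariant

end HolomorphicCorrespondence

theorem proposition4 (k : ℕ) (X : Type*) [TopologicalSpace X] [T2Space X] [CompactSpace X]
    [ConnectedSpace X] [ChartedSpace (EuclideanSpace ℂ (Fin k)) X]
    [IsManifold 𝓘(ℂ, EuclideanSpace ℂ (Fin k)) ω X]
    [MeasurableSpace X] [BorelSpace X]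
    (F : HolomorphicCorrespondence k X)
    (μ : Measure X) [IsProbabilityMeasure μ] (hμ : F.IsPullbackInvariant μ)
    (A B : Set X) (hA : MeasurableSet A) (hB : F.IsAlmostInvariant μ B) :
    (∃ L : ℝ, Tendsto
      (fun n : ℕ => (1 / (n : ℝ)) * ∑ j ∈ Finset.range n, μ.real (F.image^[j] A ∩ B))
      atTop (𝓝 L)) ∧
    Monotone (fun j : ℕ => μ.real (F.image^[j] A ∩ B)) := by
  -- Metrizability supplies inner regularity and the approximation of closed sets by continuous
  -- functions.
  have : SecondCountableTopology X :=
    ChartedSpace.secondCountable_of_sigmaCompact (EuclideanSpace ℂ (Fin k)) X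
  let _ : MetricSpace X := TopologicalSpace.metrizableSpaceMetric X
  have hmono : Monotone (fun j : ℕ => μ.real (F.image^[j] A ∩ B)) := by
    refine monotone_nat_of_le_succ fun j => ?_
    rw [Function.iterate_succ_apply']
    exact ENNReal.toReal_mono (measure_ne_top μ _) (hμ.measure_inter_le_measure_image_inter hB _)
  have hbdd : BddAbove (Set.range fun j : ℕ => μ.real (F.image^[j] A ∩ B)) :=
    ⟨1, by rintro _ ⟨j, rfl⟩; exact measureReal_le_one⟩
  exact ⟨⟨_, by simpa only [one_div] using (tendsto_atTop_ciSup hmono hbdd).cesaro⟩, hmono⟩
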